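/- Let $\mathbb{T}$ be the unit circle with normalized Lebesgue measure, let $H^2\subseteq L^2(\mathbb{T})$ be the Hardy space of functions whose Fourier coefficients at all negative integers vanish, and let $P$ be the orthogonal projection of $L^2(\mathbb{T})$ onto $H^2$. For $f\in L^\infty(\mathbb{T})$ let $H_f: H^2\to L^2(\mathbb{T})\ominus H^2$, $H_f g=(I-P)(fg)$, be the Hankel operator with symbol $f$. An inner function is a function $\theta\in H^2$ with $|\theta|=1$ a.e. on $\mathbb{T}$ (constants of modulus one are allowed). A bounded operator between Hilbert spaces is a partial isometry if it preserves the norm on the orthogonal complement of its kernel. Then, for every $f\in L^\infty(\mathbb{T})$, the Hankel operator $H_f$ is a partial isometry if and only if $\bar f$ is inner up to the analytic part of the symbol $f$, that is, if and only if there is an inner function $\theta$ such that $f-\bar\theta\in H^2$. -/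

import Mathlib

open MeasureTheory Filter
open scoped ENNReal

noncomputable section

/-- The unit circle `𝕋`, parametrized as `ℝ / 2πℤ`; the point `θ` stands for `e^{iθ}`. -/
abbrev UnitT : Type := AddCircle (2 * Real.pi)

instance fact_two_pi_pos : Fact (0 < 2 * Real.pi) := ⟨Real.two_pi_pos⟩

/-- Normalized Lebesgue measure on the unit circle. -/
abbrev measT : Measure UnitT := AddCircle.haarAddCircle

/-- The Hilbert space `L²(𝕋)`. -/
abbrev L2T : Type := Lp ℂ 2 measT

/-- The space `L^∞(𝕋)`. -/
abbrev LinfT : Type := Lp ℂ ∞ measT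

/-- The inclusion `L^∞(𝕋) ⊆ L²(𝕋)`. -/
def LinfT.toL2 (f : LinfT) : L2T :=
  ((Lp.memLp f).mono_exponent (p := 2) le_top).toLp f

theorem LinfT.coeFn_toL2 (f : LinfT) : (f.toL2 : UnitT → ℂ) =ᵐ[measT] f :=
  MemLp.coeFn_toLp _

theorem fourierCoeff_eq_inner (g : L2T) (n : ℤ) :
    fourierCoeff (g : UnitT → ℂ) n = inner ℂ (fourierLp 2 n : L2T) g := by
  rw [← fourierBasis_repr, HilbertBasis.repr_apply_apply, coe_fourierBasis]

/-- The Hardy space `H²`: the functions in `L²(𝕋)` whose Fourier coefficients at all negative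
integers vanish. -/
def hardyH2 : Submodule ℂ L2T where
  carrier := {g | ∀ n : ℤ, n < 0 → fourierCoeff (g : UnitT → ℂ) n = 0}
  zero_mem' n _ := by rw [fourierCoeff_eq_inner, inner_zero_right]
  add_mem' {a b} ha hb n hn := by
    rw [fourierCoeff_eq_inner, inner_add_right, ← fourierCoeff_eq_inner, ← fourierCoeff_eq_inner,
      ha n hn, hb n hn, add_zero]
  smul_mem' c a ha n hn := by
    rw [fourierCoeff_eq_inner, inner_smul_right, ← fourierCoeff_eq_inner, ha n hn, mul_zero]

theorem mem_hardyH2 (g : L2T) :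
    g ∈ hardyH2 ↔ ∀ n : ℤ, n < 0 → fourierCoeff (g : UnitT → ℂ) n = 0 := Iff.rfl

theorem isClosed_hardyH2 : IsClosed (hardyH2 : Set L2T) := by
  have h : (hardyH2 : Set L2T)
      = ⋂ n : ℤ, ⋂ _ : n < 0, {g | inner ℂ (fourierLp 2 n : L2T) g = 0} := by
    ext g
    simp only [SetLike.mem_coe, mem_hardyH2, Set.mem_iInter, Set.mem_ofPred_eq,
      fourierCoeff_eq_inner]
  rw [h]
  exact isClosed_iInter fun n => isClosed_iInter fun _ =>
    isClosed_eq (continuous_const.inner continuous_id) continuous_const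

instance completeSpace_hardyH2 : CompleteSpace hardyH2 :=
  isClosed_hardyH2.completeSpace_coe

/-- The multiplication operator `g ↦ φ g` on `L²(𝕋)`, for `φ ∈ L^∞(𝕋)`. -/
def mulOp (φ : LinfT) : L2T →L[ℂ] L2T :=
  (ContinuousLinearMap.mul ℂ ℂ).holderL measT ∞ 2 2 φ

theorem coeFn_mulOp (φ : LinfT) (g : L2T) :
    (mulOp φ g : UnitT → ℂ) =ᵐ[measT] fun t => φ t * g t :=
  (ContinuousLinearMap.mul ℂ ℂ).coeFn_holder φ g

/-- The Hankel operator `H_φ : H² → L² ⊖ H²`, `H_φ g = (I - P)(φ g)`; here `I - P` is the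
orthogonal projection of `L²` onto the orthogonal complement of `H²`. -/
def hankelOp (φ : LinfT) : hardyH2 →L[ℂ] hardyH2ᗮ :=
  hardyH2ᗮ.orthogonalProjectionOnto ∘L mulOp φ ∘L hardyH2.subtypeL

theorem coe_hankelOp (φ : LinfT) (g : hardyH2) :
    (hankelOp φ g : L2T) = mulOp φ g - hardyH2.starProjection (mulOp φ g) := by
  have h := hardyH2.starProjection_add_starProjection_orthogonal (mulOp φ g)
  exact eq_sub_of_add_eq' h

/-- `θ` is an inner function: it lies in `H²` and `|θ| = 1` almost everywhere on `𝕋`. -/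
def IsInnerFun (θ : L2T) : Prop :=
  θ ∈ hardyH2 ∧ ∀ᵐ t ∂measT, ‖θ t‖ = 1

/-- A bounded operator between Hilbert spaces is a partial isometry if it preserves the norm on
the orthogonal complement of its kernel. -/
def IsPartialIsom {E F : Type*} [NormedAddCommGroup E] [InnerProductSpace ℂ E]
    [NormedAddCommGroup F] [InnerProductSpace ℂ F] (A : E →L[ℂ] F) : Prop :=
  ∀ x ∈ (LinearMap.ker (A : E →ₗ[ℂ] F))ᗮ, ‖A x‖ = ‖x‖

end

/-! Let `K` be the kernel of `H_f`, a closed shift-invariant subspace, and let `b u` be the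
coefficient of `f u` at `-1`. Multiplication by `z` carries only that coefficient across into `H²`,
so `‖H_f (z u)‖² + |b u|² = ‖H_f u‖²` (`norm_sq_hankelOp_shiftH2`). If `H_f` is a partial isometry
and `u ⊥ K`, this becomes `|b u| = ‖P_K (z u)‖`. The vector `P_K (z u)` lies in `K ⊖ zK`, which by
Beurling's argument is zero or spanned by an inner `θ`. If it is zero, `b = 0` and `f` is analytic.
Otherwise `|b u| = |⟨θ, z u⟩|` on all of `H²`, so the two functionals differ by a unimodular
constant, and their values at `z^k` show that `f` and the conjugate of a multiple of `θ` have the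
same negative coefficients.

Conversely, if `f - θ̄` is analytic, then `H_f` kills `θ H²`, and for `u ⊥ θ H²` the function `θ̄ u`
is orthogonal to `H²`; thus `H_f u = θ̄ u` has the norm of `u`. -/

/-! ### Uniqueness of Fourier coefficients in `L¹`. -/

section IntegralOfFourierCoeff

/-- The functional `ψ ↦ ∫ ψ g` is continuous for the sup norm and kills the trigonometric
polynomials, which are dense. -/
theorem integral_mul_eq_zero_of_fourierCoeff_eq_zero {g : UnitT → ℂ} (hg : Integrable g measT)
    (h : ∀ n, fourierCoeff g n = 0) (φ : C(UnitT, ℂ)) : ∫ t, φ t * g t ∂measT = 0 := by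
  have hint : ∀ ψ : C(UnitT, ℂ), Integrable (fun t => ψ t * g t) measT := fun ψ =>
    hg.bdd_mul ψ.continuous.aestronglyMeasurable (.of_forall fun t => ψ.norm_coe_le_norm t)
  let L : C(UnitT, ℂ) →L[ℂ] ℂ := LinearMap.mkContinuous
    { toFun := fun ψ => ∫ t, ψ t * g t ∂measT
      map_add' := fun a b => by
        simp only [ContinuousMap.add_apply, add_mul]
        exact integral_add (hint a) (hint b)
      map_smul' := fun c a => by
        simp only [ContinuousMap.smul_apply, smul_eq_mul, mul_assoc, RingHom.id_apply]
        exact integral_const_mul _ _ }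
    (∫ t, ‖g t‖ ∂measT) (fun ψ => by
      change ‖∫ t, ψ t * g t ∂measT‖ ≤ _
      rw [mul_comm (∫ t, ‖g t‖ ∂measT), ← integral_const_mul]
      refine norm_integral_le_of_norm_le (hg.norm.const_mul _) (.of_forall fun t => ?_)
      rw [norm_mul]
      exact mul_le_mul_of_nonneg_right (ψ.norm_coe_le_norm t) (norm_nonneg _))
  have hker : (Submodule.span ℂ (Set.range (@fourier (2 * Real.pi)))).topologicalClosure
      ≤ LinearMap.ker (L : C(UnitT, ℂ) →ₗ[ℂ] ℂ) := by
    refine Submodule.topologicalClosure_minimal _ ?_ L.isClosed_ker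
    rw [Submodule.span_le]
    rintro _ ⟨n, rfl⟩
    have := h (-n)
    rw [fourierCoeff, neg_neg] at this
    exact this
  rw [span_fourier_closure_eq_top] at hker
  exact hker (Submodule.mem_top (x := φ))

/-- Indicators of closed sets are bounded pointwise limits of continuous functions, so `g`
integrates to zero over every closed set. Integrability alone must suffice, because the lemma is
applied to products of two `L²` functions. -/
theorem ae_eq_zero_of_fourierCoeff_eq_zero {g : UnitT → ℂ} (hg : Integrable g measT)
    (h : ∀ n, fourierCoeff g n = 0) : g =ᵐ[measT] 0 := by
  refine ae_eq_zero_of_forall_setIntegral_isClosed_eq_zero hg fun F hF => ?_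
  rw [← integral_indicator hF.measurableSet]
  have hlim : Tendsto (fun n : ℕ => ∫ t, ((hF.apprSeq n t : ℝ) : ℂ) * g t ∂measT) atTop
      (nhds (∫ t, F.indicator g t ∂measT)) := by
    refine tendsto_integral_of_dominated_convergence (fun t => ‖g t‖) (fun n => ?_) hg.norm
      (fun n => .of_forall fun t => ?_) (.of_forall fun t => ?_)
    · exact AEStronglyMeasurable.mul (Continuous.aestronglyMeasurable (by fun_prop)) hg.1
    · rw [norm_mul]
      refine mul_le_of_le_one_left (norm_nonneg _) ?_
      simpa using HasOuterApproxClosed.apprSeq_apply_le_one hF n t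
    · have h1 := (tendsto_pi_nhds.1 (HasOuterApproxClosed.tendsto_apprSeq hF)) t
      have h2 : Tendsto (fun n : ℕ => ((hF.apprSeq n t : ℝ) : ℂ) * g t) atTop
          (nhds ((((F.indicator (fun _ => (1 : NNReal)) t : NNReal) : ℝ) : ℂ) * g t)) := by
        refine Tendsto.mul_const _ ?_
        exact ((Complex.continuous_ofReal.comp NNReal.continuous_coe).tendsto _).comp h1
      convert h2 using 2
      by_cases ht : t ∈ F <;> simp [ht]
  refine tendsto_nhds_unique hlim ?_
  have hz : ∀ n : ℕ, ∫ t, ((hF.apprSeq n t : ℝ) : ℂ) * g t ∂measT = 0 := fun n =>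
    integral_mul_eq_zero_of_fourierCoeff_eq_zero hg h
      ⟨fun t => ((hF.apprSeq n t : ℝ) : ℂ), by fun_prop⟩
  simp only [hz, tendsto_const_nhds]

end IntegralOfFourierCoeff

/-! ### Multiplication operators and Fourier coefficients of products. -/

section MulOp

theorem inner_mulOp_left (φ : LinfT) (g k : L2T) :
    inner ℂ (mulOp φ g) k = inner ℂ g (mulOp (star φ) k) := by
  rw [L2.inner_def, L2.inner_def]
  refine integral_congr_ae ?_
  filter_upwards [coeFn_mulOp φ g, coeFn_mulOp (star φ) k, Lp.coeFn_star φ] with t h1 h2 h3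
  rw [h1, h2, h3]
  simp only [RCLike.inner_apply', map_mul, Pi.star_apply, RCLike.star_def]
  ring

theorem mulOp_comm (φ ψ : LinfT) (g : L2T) : mulOp φ (mulOp ψ g) = mulOp ψ (mulOp φ g) := by
  apply Lp.ext
  filter_upwards [coeFn_mulOp φ g, coeFn_mulOp ψ g, coeFn_mulOp φ (mulOp ψ g),
    coeFn_mulOp ψ (mulOp φ g)] with t h1 h2 h3 h4
  rw [h3, h4, h1, h2]
  ring

theorem mulOp_star_mulOp {φ : LinfT} (hφ : ∀ᵐ t ∂measT, ‖φ t‖ = 1) (g : L2T) :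
    mulOp (star φ) (mulOp φ g) = g := by
  apply Lp.ext
  filter_upwards [coeFn_mulOp φ g, coeFn_mulOp (star φ) (mulOp φ g), Lp.coeFn_star φ, hφ]
    with t h1 h2 h3 h4
  rw [h2, h1, h3, ← mul_assoc, Pi.star_apply, RCLike.star_def, RCLike.conj_mul, h4]
  simp

theorem norm_mulOp_of_norm_eq_one {φ : LinfT} (hφ : ∀ᵐ t ∂measT, ‖φ t‖ = 1) (g : L2T) :
    ‖mulOp φ g‖ = ‖g‖ := by
  have h : inner ℂ (mulOp φ g) (mulOp φ g) = inner ℂ g g := by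
    rw [inner_mulOp_left, mulOp_star_mulOp hφ]
  rw [inner_self_eq_norm_sq_to_K, inner_self_eq_norm_sq_to_K] at h
  have h' : ‖mulOp φ g‖ ^ 2 = ‖g‖ ^ 2 := by exact_mod_cast h
  exact (sq_eq_sq₀ (norm_nonneg _) (norm_nonneg _)).1 h'

theorem norm_fourierLp_top_apply (n : ℤ) :
    ∀ᵐ t ∂measT, ‖(fourierLp ∞ n : LinfT) t‖ = 1 := by
  filter_upwards [coeFn_fourierLp (T := 2 * Real.pi) ∞ n] with t h
  rw [h, fourier_apply, Circle.norm_coe]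

theorem fourierCoeff_mulOp_fourierLp_top (k n : ℤ) (g : L2T) :
    fourierCoeff (mulOp (fourierLp ∞ k) g : L2T) n = fourierCoeff (g : UnitT → ℂ) (n - k) := by
  refine integral_congr_ae ?_
  filter_upwards [coeFn_mulOp (fourierLp ∞ k) g, coeFn_fourierLp (T := 2 * Real.pi) ∞ k]
    with t h1 h2
  rw [h1, h2, neg_sub, sub_eq_add_neg, add_comm, fourier_add]
  simp only [smul_eq_mul, mul_assoc]

theorem fourierCoeff_mulOp_fourierLp (φ : LinfT) (k n : ℤ) :
    fourierCoeff (mulOp φ (fourierLp 2 k) : L2T) n = fourierCoeff (φ : UnitT → ℂ) (n - k) := by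
  refine integral_congr_ae ?_
  filter_upwards [coeFn_mulOp φ (fourierLp 2 k), coeFn_fourierLp (T := 2 * Real.pi) 2 k]
    with t h1 h2
  rw [h1, h2, neg_sub, sub_eq_add_neg, add_comm, fourier_add]
  simp only [smul_eq_mul]
  ring

theorem fourierCoeff_conj_mul (g k : L2T) (n : ℤ) :
    fourierCoeff (fun t => (starRingEnd ℂ) (g t) * k t : UnitT → ℂ) n
      = inner ℂ g (mulOp (fourierLp ∞ (-n)) k) := by
  rw [L2.inner_def]
  refine integral_congr_ae ?_
  filter_upwards [coeFn_mulOp (fourierLp ∞ (-n)) k, coeFn_fourierLp (T := 2 * Real.pi) ∞ (-n)]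
    with t h1 h2
  rw [h1, h2]
  simp only [RCLike.inner_apply', smul_eq_mul]
  ring

theorem integrable_conj_mul (g k : L2T) :
    Integrable (fun t => (starRingEnd ℂ) (g t) * k t) measT := by
  have := L2.integrable_inner (𝕜 := ℂ) g k
  simpa only [RCLike.inner_apply'] using this

/-- The inner products `⟨g, z^n k⟩` are the Fourier coefficients of `ḡ k`, so `ḡ k - c` has none
left. -/
theorem conj_mul_ae_eq_const {g k : L2T} (c : ℂ) (h0 : inner ℂ g k = c)
    (h : ∀ n : ℤ, n ≠ 0 → inner ℂ g (mulOp (fourierLp ∞ n) k) = 0) :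
    ∀ᵐ t ∂measT, (starRingEnd ℂ) (g t) * k t = c := by
  have hc : Integrable (fun _ : UnitT => -c) measT := integrable_const _
  have key : (fun t => (starRingEnd ℂ) (g t) * k t) + (fun _ => -c) =ᵐ[measT] 0 := by
    refine ae_eq_zero_of_fourierCoeff_eq_zero ((integrable_conj_mul g k).add hc) fun n => ?_
    rw [show fourierCoeff ((fun t => (starRingEnd ℂ) (g t) * k t) + fun _ => -c) n =
      fourierCoeff (fun t => (starRingEnd ℂ) (g t) * k t) n + fourierCoeff (fun _ => -c) n from
      congrFun (fourierCoeff.add (integrable_conj_mul g k) hc) n, fourierCoeff_conj_mul]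
    have h1 : fourierCoeff (fun _ : UnitT => -c) n = if n = 0 then -c else 0 := by
      have := fourierCoeff.const_mul (T := 2 * Real.pi) (fourier 0) (-c) n
      simp only [fourier_zero, mul_one] at this
      rw [this, fourierCoeff_fourier]
      simp [Pi.single_apply]
    rw [h1]
    split_ifs with hn
    · subst hn
      have hz : mulOp (fourierLp ∞ (-0)) k = k := by
        apply Lp.ext
        filter_upwards [coeFn_mulOp (fourierLp ∞ (-0)) k,
          coeFn_fourierLp (T := 2 * Real.pi) ∞ (-0)] with t h1 h2
        rw [h1, h2]
        simp
      rw [hz, h0, add_neg_cancel]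
    · rw [h _ (neg_ne_zero.2 hn), add_zero]
  filter_upwards [key] with t ht
  exact add_neg_eq_zero.1 ht

theorem mulOp_fourierLp_top_neg (n : ℤ) :
    (fourierLp ∞ (-n) : LinfT) = star (fourierLp ∞ n) := by
  apply Lp.ext
  filter_upwards [coeFn_fourierLp (T := 2 * Real.pi) ∞ n,
    coeFn_fourierLp (T := 2 * Real.pi) ∞ (-n), Lp.coeFn_star (fourierLp ∞ n : LinfT)]
    with t h1 h2 h3
  rw [h2, h3, Pi.star_apply, h1, fourier_neg, RCLike.star_def]

end MulOp

/-! ### The Hardy space and the shift. -/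

section Hardy

theorem fourierLp_mem_hardyH2 {k : ℤ} (hk : 0 ≤ k) : (fourierLp 2 k : L2T) ∈ hardyH2 := by
  intro n hn
  rw [fourierCoeff_eq_inner, (orthonormal_fourier (T := 2 * Real.pi)).2 (by lia : n ≠ k)]

theorem mem_orthogonal_hardyH2 (w : L2T) :
    w ∈ hardyH2ᗮ ↔ ∀ n : ℤ, 0 ≤ n → fourierCoeff (w : UnitT → ℂ) n = 0 := by
  refine ⟨fun h n hn => ?_, fun h => ?_⟩
  · rw [fourierCoeff_eq_inner]
    exact (Submodule.mem_orthogonal _ _).1 h _ (fourierLp_mem_hardyH2 hn)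
  · rw [Submodule.mem_orthogonal]
    intro g hg
    have hs := (fourierBasis (T := 2 * Real.pi)).hasSum_inner_mul_inner g w
    refine hs.unique ?_
    convert hasSum_zero with n
    rw [coe_fourierBasis]
    rcases lt_or_ge n 0 with hn | hn
    · rw [← inner_conj_symm, ← fourierCoeff_eq_inner, hg n hn, map_zero, zero_mul]
    · rw [← fourierCoeff_eq_inner w, h n hn, mul_zero]

/-- Expand `g` in its Fourier series: for `n < 0 ≤ k`, the coefficient of `φ z^k` at `n` is that of
`φ` at `n - k < 0`. -/
theorem mulOp_mem_hardyH2 {φ : LinfT} (hφ : ∀ n : ℤ, n < 0 → fourierCoeff (φ : UnitT → ℂ) n = 0)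
    {g : L2T} (hg : g ∈ hardyH2) : mulOp φ g ∈ hardyH2 := by
  intro n hn
  rw [fourierCoeff_eq_inner]
  have hs := (hasSum_fourier_series_L2 g).mapL
    ((innerSL ℂ (fourierLp 2 n : L2T)).comp (mulOp φ))
  refine hs.unique ?_
  convert hasSum_zero with k
  rw [map_smul, ContinuousLinearMap.comp_apply, innerSL_apply_apply, ← fourierCoeff_eq_inner,
    fourierCoeff_mulOp_fourierLp]
  rcases lt_or_ge k 0 with hk | hk
  · rw [hg k hk, zero_smul]
  · rw [hφ _ (by lia), smul_zero]

theorem toL2_mem_hardyH2_iff (f : LinfT) :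
    f.toL2 ∈ hardyH2 ↔ ∀ n : ℤ, n < 0 → fourierCoeff (f : UnitT → ℂ) n = 0 := by
  rw [mem_hardyH2]
  simp only [fourierCoeff_congr_ae f.coeFn_toL2]

theorem fourierCoeff_star (θ : L2T) (n : ℤ) :
    fourierCoeff (star θ : L2T) n = (starRingEnd ℂ) (fourierCoeff (θ : UnitT → ℂ) (-n)) := by
  rw [fourierCoeff, fourierCoeff, ← integral_conj]
  refine integral_congr_ae ?_
  filter_upwards [Lp.coeFn_star θ] with t h
  rw [h, neg_neg, Pi.star_apply, RCLike.star_def, smul_eq_mul, smul_eq_mul, map_mul, fourier_neg]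

theorem mulOp_fourierLp_top_one_fourierLp (k : ℤ) :
    mulOp (fourierLp ∞ 1) (fourierLp 2 k) = fourierLp 2 (k + 1) := by
  apply Lp.ext
  filter_upwards [coeFn_mulOp (fourierLp ∞ 1) (fourierLp 2 k),
    coeFn_fourierLp (T := 2 * Real.pi) 2 k, coeFn_fourierLp (T := 2 * Real.pi) ∞ 1,
    coeFn_fourierLp (T := 2 * Real.pi) 2 (k + 1)] with t h1 h2 h3 h4
  rw [h1, h2, h3, h4, fourier_add, mul_comm]

/-- The unilateral shift on `H²`, as the restriction of multiplication by `z`. -/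
noncomputable def shiftH2 : hardyH2 →L[ℂ] hardyH2 :=
  (mulOp (fourierLp ∞ 1) ∘L hardyH2.subtypeL).codRestrict hardyH2 fun g n hn => by
    change fourierCoeff (mulOp (fourierLp ∞ 1) g : L2T) n = 0
    rw [fourierCoeff_mulOp_fourierLp_top]
    exact g.2 _ (by lia)

theorem coe_shiftH2 (g : hardyH2) : (shiftH2 g : L2T) = mulOp (fourierLp ∞ 1) g := rfl

theorem norm_shiftH2 (g : hardyH2) : ‖shiftH2 g‖ = ‖g‖ :=
  norm_mulOp_of_norm_eq_one (norm_fourierLp_top_apply 1) g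

theorem inner_shiftH2 (g k : hardyH2) :
    inner ℂ (shiftH2 g : L2T) (shiftH2 k : L2T) = inner ℂ (g : L2T) (k : L2T) := by
  rw [coe_shiftH2, coe_shiftH2, inner_mulOp_left,
    mulOp_star_mulOp (norm_fourierLp_top_apply 1)]

theorem coe_shiftH2_iterate (n : ℕ) (g : hardyH2) :
    ((shiftH2^[n] g : hardyH2) : L2T) = mulOp (fourierLp ∞ n) g := by
  induction n with
  | zero =>
    apply Lp.ext
    filter_upwards [coeFn_mulOp (fourierLp ∞ (0 : ℕ)) g,
      coeFn_fourierLp (T := 2 * Real.pi) ∞ (0 : ℕ)] with t h1 h2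
    rw [h1, h2]
    simp
  | succ n ih =>
    rw [Function.iterate_succ_apply', coe_shiftH2, ih]
    apply Lp.ext
    filter_upwards [coeFn_mulOp (fourierLp ∞ (n + 1 : ℕ)) g, coeFn_mulOp (fourierLp ∞ n) g,
      coeFn_mulOp (fourierLp ∞ 1) (mulOp (fourierLp ∞ n) g),
      coeFn_fourierLp (T := 2 * Real.pi) ∞ (n + 1 : ℕ),
      coeFn_fourierLp (T := 2 * Real.pi) ∞ n, coeFn_fourierLp (T := 2 * Real.pi) ∞ 1]
      with t h1 h2 h3 h4 h5 h6
    rw [h3, h2, h1, h4, h5, h6]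
    push_cast
    rw [fourier_add]
    ring

end Hardy

/-! ### Hankel operators and the shift. -/

section Hankel

theorem hankelOp_eq_zero_iff (φ : LinfT) (g : hardyH2) :
    hankelOp φ g = 0 ↔ mulOp φ g ∈ hardyH2 := by
  rw [← Submodule.coe_eq_zero, coe_hankelOp, sub_eq_zero, eq_comm,
    Submodule.starProjection_eq_self_iff]

theorem shiftH2_mem_ker_hankelOp {φ : LinfT} {g : hardyH2} (hg : hankelOp φ g = 0) :
    hankelOp φ (shiftH2 g) = 0 := by
  rw [hankelOp_eq_zero_iff] at hg ⊢
  rw [coe_shiftH2, mulOp_comm]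
  exact (shiftH2 ⟨_, hg⟩).2

/-- Shifting the antianalytic part `w` of `φ g` preserves its norm and moves only the coefficient at
`-1` into `H²`; Pythagoras separates that term. -/
theorem norm_sq_hankelOp_shiftH2 (φ : LinfT) (g : hardyH2) :
    ‖hankelOp φ (shiftH2 g)‖ ^ 2 + ‖fourierCoeff (mulOp φ g : L2T) (-1)‖ ^ 2
      = ‖hankelOp φ g‖ ^ 2 := by
  set p : L2T := hardyH2.starProjection (mulOp φ g) with hp
  have hpH : p ∈ hardyH2 := Submodule.starProjection_apply_mem _ _
  set w : L2T := (hankelOp φ g : L2T) with hw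
  have hwH : w ∈ hardyH2ᗮ := (hankelOp φ g).2
  have hsum : mulOp φ g = p + w := by rw [hw, coe_hankelOp]; abel
  set c : ℂ := fourierCoeff (mulOp φ g : L2T) (-1) with hc
  have hcw : fourierCoeff (w : UnitT → ℂ) (-1) = c := by
    rw [hc, hsum, fourierCoeff_eq_inner, fourierCoeff_eq_inner, inner_add_right,
      ← fourierCoeff_eq_inner p, hpH _ (by norm_num), zero_add]
  -- The shifted antianalytic part without its constant term; this is `H_φ` of the shifted `g`.
  set z : L2T := mulOp (fourierLp ∞ 1) w - c • fourierLp 2 0 with hz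
  have hzH : z ∈ hardyH2ᗮ := by
    rw [mem_orthogonal_hardyH2]
    intro n hn
    rw [hz, fourierCoeff_eq_inner, inner_sub_right, inner_smul_right, ← fourierCoeff_eq_inner,
      fourierCoeff_mulOp_fourierLp_top]
    rcases hn.eq_or_lt with rfl | hn
    · rw [zero_sub, hcw, inner_self_eq_norm_sq_to_K,
        (orthonormal_fourier (T := 2 * Real.pi)).1]
      simp
    · rw [(mem_orthogonal_hardyH2 w).1 hwH _ (by lia),
        (orthonormal_fourier (T := 2 * Real.pi)).2 hn.ne', mul_zero, sub_zero]
  have hdec : mulOp φ (shiftH2 g) = (mulOp (fourierLp ∞ 1) p + c • fourierLp 2 0) + z := by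
    rw [coe_shiftH2, mulOp_comm, hsum, map_add, hz]
    abel
  have hmem : mulOp (fourierLp ∞ 1) p + c • fourierLp 2 0 ∈ hardyH2 :=
    hardyH2.add_mem (shiftH2 ⟨p, hpH⟩).2 (hardyH2.smul_mem _ (fourierLp_mem_hardyH2 le_rfl))
  have hHz : (hankelOp φ (shiftH2 g) : L2T) = z := by
    rw [coe_hankelOp, Submodule.eq_starProjection_of_mem_orthogonal' hmem hzH hdec, hdec,
      add_sub_cancel_left]
  have horth : inner ℂ (c • (fourierLp 2 0 : L2T)) z = 0 :=
    (Submodule.mem_orthogonal _ _).1 hzH _ (hardyH2.smul_mem _ (fourierLp_mem_hardyH2 le_rfl))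
  have hpyth := norm_add_sq_eq_norm_sq_add_norm_sq_of_inner_eq_zero _ _ horth
  have hadd : c • (fourierLp 2 0 : L2T) + z = mulOp (fourierLp ∞ 1) w := by rw [hz]; abel
  rw [hadd, norm_mulOp_of_norm_eq_one (norm_fourierLp_top_apply 1), norm_smul,
    (orthonormal_fourier (T := 2 * Real.pi)).1, mul_one] at hpyth
  have hnz : ‖hankelOp φ (shiftH2 g)‖ = ‖z‖ := by rw [← hHz]; rfl
  have hnw : ‖hankelOp φ g‖ = ‖w‖ := rfl
  rw [hnz, hnw]
  linarith [hpyth]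

end Hankel

theorem exists_norm_eq_one_forall_eq_mul {E : Type*} [AddCommGroup E] [Module ℂ E]
    (a b : E →ₗ[ℂ] ℂ) (h : ∀ x, ‖b x‖ = ‖a x‖) : ∃ c : ℂ, ‖c‖ = 1 ∧ ∀ x, b x = c * a x := by
  by_cases ha : ∀ x, a x = 0
  · exact ⟨1, norm_one, fun x => by rw [ha, mul_zero, ← norm_eq_zero, h, ha, norm_zero]⟩
  · push Not at ha
    obtain ⟨y, hy⟩ := ha
    refine ⟨b y / a y, by rw [norm_div, h, div_self (norm_ne_zero_iff.2 hy)], fun x => ?_⟩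
    -- This vector is in the kernel of `a`, hence in that of `b`.
    have hx := h (x - (a x / a y) • y)
    simp only [map_sub, map_smul, smul_eq_mul, div_mul_cancel₀ _ hy, sub_self, norm_zero,
      norm_eq_zero] at hx
    rw [sub_eq_zero.1 hx]
    ring

/-! ### Beurling's argument for the wandering subspace. -/

section Wandering

/-- The wandering subspace `K ⊖ zK` of a subspace `K` of `H²`. -/
def wandering (K : Submodule ℂ hardyH2) : Submodule ℂ hardyH2 where
  carrier := {u | u ∈ K ∧ ∀ k ∈ K, inner ℂ (shiftH2 k : L2T) (u : L2T) = 0}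
  zero_mem' := ⟨K.zero_mem, fun _ _ => inner_zero_right _⟩
  add_mem' ha hb := ⟨K.add_mem ha.1 hb.1, fun k hk => by
    rw [Submodule.coe_add, inner_add_right, ha.2 k hk, hb.2 k hk, add_zero]⟩
  smul_mem' c _ ha := ⟨K.smul_mem c ha.1, fun k hk => by
    rw [Submodule.coe_smul, inner_smul_right, ha.2 k hk, mul_zero]⟩

variable {K : Submodule ℂ hardyH2}

theorem inner_mulOp_fourierLp_of_pos (hK : ∀ k ∈ K, shiftH2 k ∈ K) {u v : hardyH2}
    (hu : u ∈ wandering K) (hv : v ∈ K) {n : ℤ} (hn : 0 < n) :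
    inner ℂ (u : L2T) (mulOp (fourierLp ∞ n) v) = 0 := by
  obtain ⟨m, rfl⟩ : ∃ m : ℕ, n = ((m + 1 : ℕ) : ℤ) := ⟨(n - 1).toNat, by lia⟩
  rw [← coe_shiftH2_iterate, Function.iterate_succ_apply',
    ← inner_conj_symm,
    hu.2 _ ((show Set.MapsTo shiftH2 (K : Set hardyH2) K from hK).iterate m hv), map_zero]

/-- For negative `n`, moving `z^n` to the other factor exchanges the roles of `u` and `v`. -/
theorem inner_mulOp_fourierLp_of_ne_zero (hK : ∀ k ∈ K, shiftH2 k ∈ K) {u v : hardyH2}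
    (hu : u ∈ wandering K) (hv : v ∈ wandering K) (n : ℤ) (hn : n ≠ 0) :
    inner ℂ (u : L2T) (mulOp (fourierLp ∞ n) v) = 0 := by
  rcases hn.lt_or_gt with hn | hn
  · rw [← neg_neg n, mulOp_fourierLp_top_neg, ← inner_mulOp_left, ← inner_conj_symm,
      inner_mulOp_fourierLp_of_pos hK hv hu.1 (neg_pos.2 hn), map_zero]
  · exact inner_mulOp_fourierLp_of_pos hK hu hv.1 hn

/-- The orthogonality `θ ⊥ z^n θ` for `n ≠ 0` says that `|θ|²` is constant. -/
theorem isInnerFun_of_mem_wandering (hK : ∀ k ∈ K, shiftH2 k ∈ K) {θ : hardyH2}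
    (hθ : θ ∈ wandering K) (hn : ‖θ‖ = 1) : IsInnerFun (θ : L2T) := by
  refine ⟨θ.2, ?_⟩
  have h0 : inner ℂ (θ : L2T) (θ : L2T) = 1 := by
    rw [inner_self_eq_norm_sq_to_K, ← Submodule.coe_norm, hn]
    simp
  filter_upwards [conj_mul_ae_eq_const 1 h0 (inner_mulOp_fourierLp_of_ne_zero hK hθ hθ)] with t ht
  have := congrArg norm ht
  rw [norm_mul, RCLike.norm_conj, norm_one] at this
  nlinarith [norm_nonneg ((θ : L2T) t)]

/-- The part `v` of `u` orthogonal to `θ` is again wandering, so every Fourier coefficient of `θ̄ v`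
vanishes; since `|θ| = 1`, `v = 0`. -/
theorem eq_smul_of_mem_wandering (hK : ∀ k ∈ K, shiftH2 k ∈ K) {θ u : hardyH2}
    (hθ : θ ∈ wandering K) (hn : ‖θ‖ = 1) (hu : u ∈ wandering K) :
    u = (inner ℂ (θ : L2T) (u : L2T) : ℂ) • θ := by
  set v : hardyH2 := u - (inner ℂ (θ : L2T) (u : L2T) : ℂ) • θ with hv
  have hvW : v ∈ wandering K := (wandering K).sub_mem hu ((wandering K).smul_mem _ hθ)
  have h0 : inner ℂ (θ : L2T) (v : L2T) = 0 := by
    rw [hv, Submodule.coe_sub, Submodule.coe_smul, inner_sub_right, inner_smul_right,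
      inner_self_eq_norm_sq_to_K, ← Submodule.coe_norm, hn]
    simp
  have hzero : (v : L2T) = 0 := by
    rw [Lp.eq_zero_iff_ae_eq_zero]
    filter_upwards [conj_mul_ae_eq_const 0 h0 (inner_mulOp_fourierLp_of_ne_zero hK hθ hvW),
      (isInnerFun_of_mem_wandering hK hθ hn).2] with t h1 h2
    refine (mul_eq_zero.1 h1).resolve_left fun h3 => ?_
    rw [← norm_eq_zero, RCLike.norm_conj, h2] at h3
    exact one_ne_zero h3
  exact sub_eq_zero.1 (Submodule.coe_eq_zero.1 hzero)

/-- For `k ∈ K`, `⟨zk, P_K (zu)⟩ = ⟨zk, zu⟩ = ⟨k, u⟩ = 0`. -/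
theorem starProjection_shiftH2_mem_wandering [K.HasOrthogonalProjection]
    (hK : ∀ k ∈ K, shiftH2 k ∈ K) {u : hardyH2} (hu : u ∈ Kᗮ) :
    K.starProjection (shiftH2 u) ∈ wandering K := by
  refine ⟨Submodule.starProjection_apply_mem _ _, fun k hk => ?_⟩
  rw [← Submodule.coe_inner, ← Submodule.inner_starProjection_left_eq_right,
    Submodule.starProjection_eq_self_iff.2 (hK k hk), Submodule.coe_inner, inner_shiftH2]
  exact (Submodule.mem_orthogonal _ _).1 hu k hk

end Wandering

theorem isInnerFun_smul {θ : L2T} (hθ : IsInnerFun θ) {c : ℂ} (hc : ‖c‖ = 1) :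
    IsInnerFun (c • θ) := by
  refine ⟨hardyH2.smul_mem c hθ.1, ?_⟩
  filter_upwards [hθ.2, Lp.coeFn_smul c θ] with t h1 h2
  rw [h2, Pi.smul_apply, norm_smul, h1, hc, one_mul]

theorem isInnerFun_fourierLp_zero : IsInnerFun (fourierLp 2 0) := by
  refine ⟨fourierLp_mem_hardyH2 le_rfl, ?_⟩
  filter_upwards [coeFn_fourierLp (T := 2 * Real.pi) 2 0] with t h
  rw [h, fourier_zero, norm_one]

theorem star_fourierLp_zero : star (fourierLp 2 0 : L2T) = fourierLp 2 0 := by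
  apply Lp.ext
  filter_upwards [coeFn_fourierLp (T := 2 * Real.pi) 2 0, Lp.coeFn_star (fourierLp 2 0 : L2T)]
    with t h1 h2
  rw [h2, Pi.star_apply, h1, fourier_zero, star_one]

/-! ### From partial isometry to inner function. -/

section PartialIsom

/-- Here `‖H_f u‖ = ‖u‖ = ‖zu‖`, while `‖H_f (zu)‖` is the norm of the component of `zu` orthogonal
to the kernel; the shift identity leaves the other component. -/
theorem norm_fourierCoeff_mulOp_eq {f : LinfT} (hf : IsPartialIsom (hankelOp f))
    [(LinearMap.ker (hankelOp f : hardyH2 →ₗ[ℂ] hardyH2ᗮ)).HasOrthogonalProjection]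
    {u : hardyH2} (hu : u ∈ (LinearMap.ker (hankelOp f : hardyH2 →ₗ[ℂ] hardyH2ᗮ))ᗮ) :
    ‖fourierCoeff (mulOp f u : L2T) (-1)‖ =
      ‖(LinearMap.ker (hankelOp f : hardyH2 →ₗ[ℂ] hardyH2ᗮ)).starProjection (shiftH2 u)‖ := by
  set K := LinearMap.ker (hankelOp f : hardyH2 →ₗ[ℂ] hardyH2ᗮ) with hKdef
  have h1 := norm_sq_hankelOp_shiftH2 f u
  rw [hf u hu] at h1
  have hdec := K.starProjection_add_starProjection_orthogonal (shiftH2 u)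
  have hk : hankelOp f (K.starProjection (shiftH2 u)) = 0 :=
    K.starProjection_apply_mem (shiftH2 u)
  have h2 : ‖hankelOp f (shiftH2 u)‖ = ‖Kᗮ.starProjection (shiftH2 u)‖ := by
    rw [← hf _ (Kᗮ.starProjection_apply_mem (shiftH2 u))]
    conv_lhs => rw [← hdec, map_add, hk, zero_add]
  have h3 := K.norm_sq_eq_add_norm_sq_starProjection (shiftH2 u)
  rw [norm_shiftH2] at h3
  rw [h2] at h1
  refine (sq_eq_sq₀ (norm_nonneg _) (norm_nonneg _)).1 ?_
  linarith

theorem exists_inner_of_isPartialIsom {f : LinfT} (hf : IsPartialIsom (hankelOp f)) :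
    ∃ θ : L2T, IsInnerFun θ ∧ f.toL2 - star θ ∈ hardyH2 := by
  set K := LinearMap.ker (hankelOp f : hardyH2 →ₗ[ℂ] hardyH2ᗮ) with hKdef
  have : CompleteSpace K := (hankelOp f).isClosed_ker.completeSpace_coe
  have hK : ∀ k ∈ K, shiftH2 k ∈ K := fun k hk => shiftH2_mem_ker_hankelOp hk
  let b : hardyH2 →ₗ[ℂ] ℂ :=
    (innerSL ℂ (fourierLp 2 (-1) : L2T) ∘L mulOp f ∘L hardyH2.subtypeL : hardyH2 →L[ℂ] ℂ)
  have hb : ∀ u : hardyH2, b u = fourierCoeff (mulOp f u : L2T) (-1) := fun u =>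
    (fourierCoeff_eq_inner _ _).symm
  have hbK : ∀ u ∈ K, b u = 0 := fun u hu => by
    rw [hb]
    exact (hankelOp_eq_zero_iff f u).1 hu _ (by norm_num)
  have hbproj : ∀ u, b u = b (Kᗮ.starProjection u) := fun u => by
    conv_lhs => rw [← K.starProjection_add_starProjection_orthogonal u, map_add,
      hbK _ (K.starProjection_apply_mem u), zero_add]
  have hbP : ∀ u ∈ Kᗮ, ‖b u‖ = ‖K.starProjection (shiftH2 u)‖ := fun u hu => by
    rw [hb]
    exact norm_fourierCoeff_mulOp_eq hf hu
  -- Testing `b` on `z^(-1-n)` moves the coefficient of `f` at `n` to `-1`, so `b` encodes the whole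
  -- antianalytic part of `f`.
  have hbe : ∀ n : ℤ, (hn : n < 0) →
      b ⟨_, fourierLp_mem_hardyH2 (by lia : 0 ≤ -1 - n)⟩ = fourierCoeff (f : UnitT → ℂ) n :=
    fun n hn => by rw [hb, fourierCoeff_mulOp_fourierLp]; congr 1; ring
  by_cases hW : wandering K = ⊥
  · refine ⟨fourierLp 2 0, isInnerFun_fourierLp_zero, ?_⟩
    rw [star_fourierLp_zero]
    refine hardyH2.sub_mem ?_ (fourierLp_mem_hardyH2 le_rfl)
    rw [toL2_mem_hardyH2_iff]
    intro n hn
    rw [← hbe n hn, hbproj, ← norm_eq_zero, hbP _ (Kᗮ.starProjection_apply_mem _), norm_eq_zero]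
    have := starProjection_shiftH2_mem_wandering hK (Kᗮ.starProjection_apply_mem
      (⟨_, fourierLp_mem_hardyH2 (by lia : 0 ≤ -1 - n)⟩ : hardyH2))
    rwa [hW, Submodule.mem_bot] at this
  · obtain ⟨θ₀, hθ₀, hne⟩ := Submodule.exists_mem_ne_zero_of_ne_bot hW
    obtain ⟨θ, hθ, hn⟩ : ∃ θ ∈ wandering K, ‖θ‖ = 1 :=
      ⟨((‖θ₀‖⁻¹ : ℝ) : ℂ) • θ₀, (wandering K).smul_mem _ hθ₀, by
        rw [norm_smul, Complex.norm_real, norm_inv, norm_norm,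
          inv_mul_cancel₀ (norm_ne_zero_iff.2 hne)]⟩
    let a : hardyH2 →ₗ[ℂ] ℂ := (innerSL ℂ θ ∘L shiftH2 : hardyH2 →L[ℂ] ℂ)
    have ha : ∀ u, a u = inner ℂ (θ : L2T) (shiftH2 u : L2T) := fun u => rfl
    have haK : ∀ u ∈ K, a u = 0 := fun u hu => by
      exact (ha u).trans (inner_eq_zero_symm.1 (hθ.2 u hu))
    -- Both functionals vanish on `K`, so it suffices to compare them on its complement, where `P_K
    -- (zu)` is a multiple of the unit vector `θ`.
    have habs : ∀ u, ‖b u‖ = ‖a u‖ := fun u => by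
      have hau : a u = a (Kᗮ.starProjection u) := by
        conv_lhs => rw [← K.starProjection_add_starProjection_orthogonal u, map_add,
          haK _ (K.starProjection_apply_mem u), zero_add]
      have hmem := Kᗮ.starProjection_apply_mem u
      rw [hbproj, hau, hbP _ hmem, eq_smul_of_mem_wandering hK hθ hn
        (starProjection_shiftH2_mem_wandering hK hmem), norm_smul, hn, mul_one,
        ← Submodule.coe_inner, ← Submodule.inner_starProjection_left_eq_right,
        Submodule.starProjection_eq_self_iff.2 hθ.1, ha, Submodule.coe_inner]
    obtain ⟨c, hc, hab⟩ := exists_norm_eq_one_forall_eq_mul a b habs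
    -- The constant is conjugated because `star` conjugates it back to the `c` of `b = c a`.
    refine ⟨(starRingEnd ℂ) c • (θ : L2T), isInnerFun_smul
      (isInnerFun_of_mem_wandering hK hθ hn) (by rw [RCLike.norm_conj, hc]), fun n hneg => ?_⟩
    have hshift : a ⟨_, fourierLp_mem_hardyH2 (by lia : 0 ≤ -1 - n)⟩
        = (starRingEnd ℂ) (fourierCoeff ((θ : L2T) : UnitT → ℂ) (-n)) := by
      rw [ha, coe_shiftH2, mulOp_fourierLp_top_one_fourierLp,
        fourierCoeff_eq_inner, inner_conj_symm]
      congr 2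
      ring
    rw [fourierCoeff_eq_inner, inner_sub_right, ← fourierCoeff_eq_inner, ← fourierCoeff_eq_inner,
      fourierCoeff_star, fourierCoeff_eq_inner _ (-n), inner_smul_right, ← fourierCoeff_eq_inner,
      map_mul, RCLike.conj_conj, fourierCoeff_congr_ae f.coeFn_toL2, ← hbe n hneg, hab, hshift,
      sub_self]

end PartialIsom

/-! ### From inner function to partial isometry. -/

theorem exists_linf_of_norm_eq_one {θ : L2T} (hθ : ∀ᵐ t ∂measT, ‖θ t‖ = 1) :
    ∃ φ : LinfT, φ.toL2 = θ := by
  have hm : MemLp (θ : UnitT → ℂ) ∞ measT :=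
    memLp_top_of_bound (Lp.aestronglyMeasurable θ) 1 (hθ.mono fun t ht => ht.le)
  refine ⟨hm.toLp _, Lp.ext ?_⟩
  exact (LinfT.coeFn_toL2 _).trans hm.coeFn_toLp

theorem toL2_star (φ : LinfT) : (star φ).toL2 = star φ.toL2 := by
  apply Lp.ext
  filter_upwards [(star φ).coeFn_toL2, Lp.coeFn_star φ, Lp.coeFn_star φ.toL2, φ.coeFn_toL2]
    with t h1 h2 h3 h4
  rw [h1, h2, h3, Pi.star_apply, Pi.star_apply, h4]

theorem toL2_sub (φ ψ : LinfT) : (φ - ψ).toL2 = φ.toL2 - ψ.toL2 := by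
  apply Lp.ext
  filter_upwards [(φ - ψ).coeFn_toL2, φ.coeFn_toL2, ψ.coeFn_toL2, Lp.coeFn_sub φ ψ,
    Lp.coeFn_sub φ.toL2 ψ.toL2] with t h1 h2 h3 h4 h5
  rw [h1, h4, h5, Pi.sub_apply, Pi.sub_apply, h2, h3]

theorem isPartialIsom_hankelOp_of_inner {f φ : LinfT} (hφ : IsInnerFun φ.toL2)
    (hf : f.toL2 - star φ.toL2 ∈ hardyH2) : IsPartialIsom (hankelOp f) := by
  have hφ1 : ∀ᵐ t ∂measT, ‖φ t‖ = 1 := by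
    filter_upwards [hφ.2, φ.coeFn_toL2] with t h1 h2
    rwa [← h2]
  have hφs : ∀ᵐ t ∂measT, ‖(star φ) t‖ = 1 := by
    filter_upwards [hφ1, Lp.coeFn_star φ] with t h1 h2
    rwa [h2, Pi.star_apply, norm_star]
  have hφH : ∀ g ∈ hardyH2, mulOp φ g ∈ hardyH2 := fun g hg =>
    mulOp_mem_hardyH2 ((toL2_mem_hardyH2_iff φ).1 hφ.1) hg
  have hsub : ∀ g ∈ hardyH2, mulOp f g - mulOp (star φ) g ∈ hardyH2 := fun g hg => by
    rw [← toL2_star, ← toL2_sub, toL2_mem_hardyH2_iff] at hf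
    have := mulOp_mem_hardyH2 hf hg
    rwa [show mulOp (f - star φ) = mulOp f - mulOp (star φ) from map_sub _ _ _] at this
  intro u hu
  -- The kernel contains `φ H²`, since `f φ g` differs from `φ̄ φ g = g` by an element of `H²`;
  -- hence `u ⊥ φ H²`, that is, `φ̄ u ⊥ H²`.
  have horth : mulOp (star φ) u ∈ hardyH2ᗮ := by
    rw [Submodule.mem_orthogonal]
    intro g hg
    rw [← inner_mulOp_left]
    refine (Submodule.mem_orthogonal _ _).1 hu ⟨mulOp φ g, hφH g hg⟩ ?_
    refine (hankelOp_eq_zero_iff f _).2 ?_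
    have := hardyH2.add_mem (hsub _ (hφH g hg)) hg
    rwa [mulOp_star_mulOp hφ1, sub_add_cancel] at this
  have hcoe : (hankelOp f u : L2T) = mulOp (star φ) u := by
    rw [coe_hankelOp, Submodule.eq_starProjection_of_mem_orthogonal' (hsub _ u.2) horth
      (sub_add_cancel _ _).symm, sub_sub_cancel]
  calc ‖hankelOp f u‖ = ‖(hankelOp f u : L2T)‖ := rfl
    _ = ‖u‖ := by rw [hcoe, norm_mulOp_of_norm_eq_one hφs]; rfl

theorem corollary4p2 (f : LinfT) :
    IsPartialIsom (hankelOp f) ↔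
      ∃ θ : L2T, IsInnerFun θ ∧ f.toL2 - star θ ∈ hardyH2 := by
  refine ⟨exists_inner_of_isPartialIsom, ?_⟩
  rintro ⟨θ, hθ, hf⟩
  obtain ⟨φ, rfl⟩ := exists_linf_of_norm_eq_one hθ.2
  exact isPartialIsom_hankelOp_of_inner hθ hf
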